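/- Let $K$ be an algebraically closed field and let $k\ge 2$ be an integer; if $\operatorname{char}K=p>0$, assume that $k$ is coprime to $p$. For $\alpha\in K$ let $v_\alpha$ denote the $(z-\alpha)$-adic valuation on $K(z)$. Call $\alpha\in K$ \emph{calm} if $\alpha=0$ or $\alpha$ is a root of unity of order not coprime to $k$, and \emph{anxious} otherwise. Call a finite sequence of rational functions \emph{calm} if none of its terms has a pole at an anxious number. A power series $\sum_i a_iz^i\in K[[z]]$ is \emph{$k$-regular} if the sequences $(a_{k^e i+r})_{i\ge 0}$, for $e\ge 0$ and $0\le r<k^e$, span a finite-dimensional $K$-vector space. A \emph{Mahler equation of order $n\ge 0$} for $f\in K[[z]]$ is an equation $f(z)=\sum_{i=1}^n c_i(z)f(z^{k^i})$ in $K((z))$ with $c_1,\dots,c_n\in K(z)$ (for $n=0$ it reads $f=0$). Let $f\in K[[z]]$ satisfy the Mahler equation $$f(z)=\sum_{i=1}^n c_i(z)\,f(z^{k^i})$$ and no Mahler equation of order lower than $n$. In the ring $K(z)[\Delta_k]$ of Mahler operators, where $\Delta_k c(z)=c(z^k)\Delta_k$ for $c\in K(z)$, define for a sequence $(\psi_i)_{i\ge1}$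 in $K(z)$ and $m\ge 0$ the operators $$\Gamma_m=\Bigl(1+\sum_{i=1}^m\psi_i(z)\Delta_k^i\Bigr)\Bigl(1-\sum_{i=1}^n c_i(z)\Delta_k^i\Bigr)=1-\sum_{i=1}^{n+m}d_{i,m}(z)\Delta_k^i .$$ The \emph{special operators} are the $\Gamma_m$ obtained from the sequence $(\psi_m)$ defined recursively by $\psi_m=d_{m,m-1}$ for $m\ge 1$ (note that $d_{m,m-1}$ depends only on $\psi_1,\dots,\psi_{m-1}$); from now on $d_{i,m}$ denotes their coefficients. Put $$V=\{\alpha\in K:\ \alpha\text{ is anxious and } v_\alpha(c_i)<0\text{ for some }1\le i\le n\}.$$ If $V$ contains no roots of unity, then the following conditions are equivalent: (i) for every $\alpha\in V$ there exists an integer $m\ge 0$ such that $v_\alpha(d_{i,m})\ge 0$ for all $m+1\le i\le m+n$, and $v_{\alpha^{k^j}}(c_i)\ge 0$ for all $j>m$ and $1\le i\le n$; (ii) $f$ satisfies a Mahler equation (of some order) with a calm sequence of coefficients; (iii) $f$ is $k$-regular. -/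

import Mathlib

noncomputable section

namespace MahlerRegularity

open Polynomial
open scoped LaurentSeries RatFunc

variable {K : Type*} [Field K]

/-! ### Regular series -/

/-- The `k`-kernel of a sequence: all subsequences `i ↦ a (k ^ e * i + r)` with `0 ≤ r < k ^ e`. -/
def kKernel (k : ℕ) (a : ℕ → K) : Set (ℕ → K) :=
  {b | ∃ e r : ℕ, r < k ^ e ∧ b = fun i => a (k ^ e * i + r)}

/-- A sequence is `k`-regular if its `k`-kernel spans a finite-dimensional `K`-vector space. -/
def IsRegularSeq (k : ℕ) (a : ℕ → K) : Prop :=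
  FiniteDimensional K (Submodule.span K (kKernel k a))

/-- A power series is `k`-regular if the sequence of its coefficients is. -/
def IsRegularSeries (k : ℕ) (f : PowerSeries K) : Prop :=
  IsRegularSeq k (fun i => PowerSeries.coeff i f)

/-! ### Mahler equations -/

/-- `f` satisfies the Mahler equation `f(z) = ∑_{i=1}^n c_i(z) f(z^{k^i})` of order `n`, an identity
in the field of Laurent series. Only the values `c 1, …, c n` matter. -/
def SatisfiesMahlerEq (k : ℕ) (hk : 2 ≤ k) (f : PowerSeries K) (n : ℕ) (c : ℕ → RatFunc K) : Prop :=
  (f : K⸨X⸩) = ∑ i ∈ Finset.Icc 1 n,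
    algebraMap (RatFunc K) K⸨X⸩ (c i) *
      (PowerSeries.expand (k ^ i) (pow_ne_zero i (by omega)) f : PowerSeries K)

/-! ### Calm numbers and calm functions -/

/-- The prime ideal `(z - α)` of `K[z]`. -/
def primeAt (α : K) : IsDedekindDomain.HeightOneSpectrum K[X] where
  asIdeal := Ideal.span {X - C α}
  isPrime := (Ideal.span_singleton_prime (X_sub_C_ne_zero α)).2 (prime_X_sub_C α)
  ne_bot := by simpa [Ideal.span_singleton_eq_bot] using X_sub_C_ne_zero α

/-- The `(z - α)`-adic valuation `v_α` on `K(z)`, in multiplicative notation: the value of a nonzero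
`c` is `exp (-v_α(c))`, and the value of `0` is `0`. -/
def valAt (α : K) : Valuation (RatFunc K) (WithZero (Multiplicative ℤ)) :=
  (primeAt α).valuation (RatFunc K)

/-- `v_α(c) ≥ 0`, that is, `c` has no pole at `α`. -/
def NoPoleAt (α : K) (c : RatFunc K) : Prop := valAt α c ≤ 1

/-- `α` is `k`-calm: it is zero or a root of unity of order not coprime to `k`. -/
def IsCalm (k : ℕ) (α : K) : Prop :=
  α = 0 ∨ (IsOfFinOrder α ∧ ¬ (orderOf α).Coprime k)

/-- `α` is `k`-anxious. -/
def IsAnxious (k : ℕ) (α : K) : Prop := ¬ IsCalm k α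

/-- The sequence `c 1, …, c n` is `k`-calm: none of its terms has a pole at a `k`-anxious number. -/
def IsCalmSeq (k n : ℕ) (c : ℕ → RatFunc K) : Prop :=
  ∀ i, 1 ≤ i → i ≤ n → ∀ α : K, IsAnxious k α → NoPoleAt α (c i)

/-- The set of `k`-anxious poles of `c 1, …, c n`. -/
def anxiousPoles (k n : ℕ) (c : ℕ → RatFunc K) : Set K :=
  {α | IsAnxious k α ∧ ∃ i, 1 ≤ i ∧ i ≤ n ∧ ¬ NoPoleAt α (c i)}

/-! ### The ring of Mahler operators -/

/-- The substitution `c(z) ↦ c(z^k)` on `K(z)`. -/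
def substPow (k : ℕ) (hk : 2 ≤ k) : RatFunc K →+* RatFunc K :=
  RatFunc.mapRingHom (Polynomial.expand K k)
    (nonZeroDivisors_le_comap_nonZeroDivisors_of_injective _
      (Polynomial.expand_injective (by omega)))

/-- The action of `ℕ` on `K(z)` in which `i` acts by `c(z) ↦ c(z^{k^i})`. -/
abbrev mahlerAction (K : Type*) [Field K] (k : ℕ) (hk : 2 ≤ k) :
    MulSemiringAction (Multiplicative ℕ) (RatFunc K) :=
  MulSemiringAction.compHom (RatFunc K) (powersHom (RatFunc K →+* RatFunc K) (substPow k hk))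

/-- The elements `∑ b_i(z) Δ_k^i` of the ring `K(z)[Δ_k]` of Mahler operators. Its multiplication,
with `Δ_k c(z) = c(z^k) Δ_k`, is that of skew polynomials for `mahlerAction K k`. -/
abbrev MahlerOp (K : Type*) [Field K] : Type _ := SkewPolynomial (RatFunc K)

/-- The operator `1 - ∑_{i=1}^n c_i(z) Δ_k^i`. -/
def equationOp (n : ℕ) (c : ℕ → RatFunc K) : MahlerOp K :=
  1 - ∑ i ∈ Finset.Icc 1 n, SkewPolynomial.monomial i (c i)

/-- The operator `1 + ∑_{i=1}^m ψ_i(z) Δ_k^i`. -/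
def multiplierOp (ψ : ℕ → RatFunc K) (m : ℕ) : MahlerOp K :=
  1 + ∑ i ∈ Finset.Icc 1 m, SkewPolynomial.monomial i (ψ i)

/-- `Γ_m(ψ) = (1 + ∑_{i=1}^m ψ_i Δ_k^i) (1 - ∑_{i=1}^n c_i Δ_k^i)`. -/
def gammaOp (k : ℕ) (hk : 2 ≤ k) (n : ℕ) (c ψ : ℕ → RatFunc K) (m : ℕ) : MahlerOp K :=
  letI := mahlerAction K k hk
  multiplierOp ψ m * equationOp n c

/-- The coefficients `d_{i,m}` in `Γ_m(ψ) = 1 - ∑_{i=1}^{n+m} d_{i,m} Δ_k^i` (for `1 ≤ i`). -/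
def gammaCoeff (k : ℕ) (hk : 2 ≤ k) (n : ℕ) (c ψ : ℕ → RatFunc K) (i m : ℕ) : RatFunc K :=
  -(gammaOp k hk n c ψ m).coeff i

/-- The sequence `ψ_m` defined recursively by `ψ_m = d_{m,m-1}` (for `1 ≤ m`); the coefficient
`d_{m,m-1}` of `Γ_{m-1}(ψ)` only involves `ψ_i` for `1 ≤ i < m`. -/
def specialPsi (k : ℕ) (hk : 2 ≤ k) (n : ℕ) (c : ℕ → RatFunc K) (m : ℕ) : RatFunc K :=
  gammaCoeff k hk n c (fun i => if _h : i < m then specialPsi k hk n c i else 0) m (m - 1)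
termination_by m

/-- The recursion `ψ_m = d_{m,m-1}` that characterises `specialPsi`. -/
theorem specialPsi_eq (k : ℕ) (hk : 2 ≤ k) (n : ℕ) (c : ℕ → RatFunc K) (m : ℕ) (hm : 1 ≤ m) :
    specialPsi k hk n c m = gammaCoeff k hk n c (specialPsi k hk n c) m (m - 1) := by
  rw [specialPsi]
  have h : multiplierOp (fun i => if _h : i < m then specialPsi k hk n c i else 0) (m - 1)
      = multiplierOp (specialPsi k hk n c) (m - 1) := by
    unfold multiplierOp
    congr 1
    refine Finset.sum_congr rfl fun i hi => ?_
    have : i < m := by have := (Finset.mem_Icc.1 hi).2; omega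
    simp [this]
  unfold gammaCoeff gammaOp
  rw [h]

/-- The coefficients `d_{i,m}` of the special operators `Γ_m = 1 - ∑ d_{i,m} Δ_k^i`. -/
def specialCoeff (k : ℕ) (hk : 2 ≤ k) (n : ℕ) (c : ℕ → RatFunc K) (i m : ℕ) : RatFunc K :=
  gammaCoeff k hk n c (specialPsi k hk n c) i m

end MahlerRegularity

end

/-!
Write `Δ` for `f(z) ↦ f(z^k)`. Everything rests on the Cartier operators
`Λ_{q,r} : ∑ a_i z^i ↦ ∑ a_{q i + r} z^i`, which satisfy `Λ_{q,r}(a(z) g(z^q)) = Λ_{q,r}(a) g`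
(`cartier_mul_expand`), map polynomials to polynomials, and, for `q = k^e` and `r < q`, send `f` to
the elements of its `k`-kernel. Denominators are cleared throughout, so that the arguments take
place in the `K[z]`-module `K[[z]]`.

*Special operators.* The coefficients of `Γ_m` at `Δ, …, Δ^m` vanish, so `Γ_m` expresses `f` through
`Δ^{m+1} f, …, Δ^{m+n} f` with coefficients `d_{i,m}` (`SatisfiesMahlerEq.eq_sum_specialCoeff`).
These `n` series are linearly independent over `K(z)` by minimality of the order
(`eq_zero_of_sum_mul_shift_eq_zero`), so there is only one such expression.

*From special operators to a calm equation.* The condition on the `d_{i,m}` says that, locally at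
each anxious `α`, `f` is in the span of the `Δ^i f`, `i ≥ 1`. The polynomials `p` for which `p f` is
a `K[z]`-combination of these series form an ideal of `K[z]`; its generator has no anxious root, and
dividing by it yields a calm equation (`exists_calm_of_forall_anxious`).

*From a calm equation to regularity.* If the polynomial `p` has only calm roots, there is a product
`g` of polynomials `z^M - 1` such that `p g` divides `z^s g(z^{k^i})` for some `s` and all `i ≥ 1`
(`exists_mul_dvd_of_roots_calm`). Hence `F = f / g` satisfies `z^s F = ∑ q_i Δ^i F` with polynomials
`q_i`, and for large `D` the finite-dimensional space of all `z^{-D} ∑_{i ≤ n} a_i Δ^i F` with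
`deg a_i ≤ 2 D` contains `f = g F` and is stable under the operators `Λ_{k,r}`
(`X_pow_mul_cartier_mem`).

*From regularity to special operators.* Each `Λ_{k^e,r} f` is a `K(z)`-combination of
`f, …, Δ^{n-1} f`; if `f` is regular, one common denominator `P` serves for all of them
(`exists_uniform_denom`). Applying `Δ^{m+1}` and `f = ∑_r z^r Δ^{m+1} Λ_{k^{m+1},r} f` gives an
expression of `f` through `Δ^{m+1} f, …, Δ^{m+n} f` with denominator `P(z^{k^{m+1}})`. By uniqueness
the `d_{i,m}` have no pole at `α` unless `P(α^{k^{m+1}}) = 0`, and if `α` is neither zero nor a root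
of unity, its orbit meets the zeros of a polynomial only finitely often.
-/

noncomputable section

namespace MahlerRegularity

open Polynomial
open scoped LaurentSeries RatFunc

variable {K : Type*} [Field K]

/-! ### Cartier operators -/

/-- The Cartier operator `∑ a_i z^i ↦ ∑ a_{q i + r} z^i` on power series. -/
def cartier (q r : ℕ) : PowerSeries K →ₗ[K] PowerSeries K where
  toFun g := PowerSeries.mk fun i => PowerSeries.coeff (q * i + r) g
  map_add' g h := by ext; simp
  map_smul' a g := by ext; simp

@[simp]
theorem coeff_cartier (q r i : ℕ) (g : PowerSeries K) :
    PowerSeries.coeff i (cartier q r g) = PowerSeries.coeff (q * i + r) g := by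
  simp [cartier]

theorem cartier_mul_expand {q r : ℕ} (hq : q ≠ 0) (hr : r < q) (a g : PowerSeries K) :
    cartier q r (a * PowerSeries.expand q hq g) = cartier q r a * g := by
  ext i
  rw [coeff_cartier, PowerSeries.coeff_mul, PowerSeries.coeff_mul]
  symm
  refine Finset.sum_of_injOn (fun x => (q * x.1 + r, q * x.2)) ?_ ?_ ?_ ?_
  · rintro ⟨x, y⟩ _ ⟨x', y'⟩ _ h
    simp only [Prod.mk.injEq, add_left_inj, mul_eq_mul_left_iff, hq, or_false] at h
    simp [h]
  · rintro ⟨x, y⟩ h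
    rw [Finset.mem_coe, Finset.HasAntidiagonal.mem_antidiagonal] at h ⊢
    simp only at h ⊢
    rw [← h]
    ring
  · rintro ⟨x, y⟩ h hxy
    simp only [Finset.HasAntidiagonal.mem_antidiagonal] at h
    rw [PowerSeries.coeff_expand_of_not_dvd, mul_zero]
    rintro ⟨y', rfl⟩
    refine hxy ⟨(i - y', y'), ?_, ?_⟩
    · have : y' < i + 1 := by
        by_contra hc
        have : q * (i + 1) ≤ q * y' := Nat.mul_le_mul_left _ (by omega)
        rw [mul_add] at this
        omega
      rw [Finset.mem_coe, Finset.HasAntidiagonal.mem_antidiagonal]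
      simp only
      omega
    · have : y' ≤ i := by
        by_contra hc
        have : q * (i + 1) ≤ q * y' := Nat.mul_le_mul_left _ (by omega)
        rw [mul_add] at this
        omega
      obtain ⟨d, rfl⟩ := Nat.exists_eq_add_of_le this
      simp only [Prod.mk.injEq, and_true]
      rw [mul_add] at h
      simp
      omega
  · rintro ⟨x, y⟩ _
    simp only [coeff_cartier]
    rw [PowerSeries.coeff_expand_mul]

theorem sum_X_pow_mul_expand_cartier {q : ℕ} (hq : q ≠ 0) (g : PowerSeries K) :
    ∑ r ∈ Finset.range q, PowerSeries.X ^ r * PowerSeries.expand q hq (cartier q r g) = g := by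
  ext i
  rw [map_sum, Finset.sum_eq_single (i % q)]
  · rw [PowerSeries.coeff_X_pow_mul', if_pos (Nat.mod_le _ _)]
    have h : i - i % q = q * (i / q) := by have := Nat.div_add_mod i q; omega
    rw [h, PowerSeries.coeff_expand_mul, coeff_cartier, Nat.div_add_mod]
  · intro r hr hne
    rw [PowerSeries.coeff_X_pow_mul']
    split_ifs with h
    · refine PowerSeries.coeff_expand_of_not_dvd q hq _ ?_
      rintro ⟨d, hd⟩
      apply hne
      have : i = r + q * d := by omega
      rw [this, Nat.add_mul_mod_self_left, Nat.mod_eq_of_lt (Finset.mem_range.1 hr)]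
    · rfl
  · intro h
    exact absurd (Finset.mem_range.2 (Nat.mod_lt _ (Nat.pos_of_ne_zero hq))) h

theorem exists_cartier_ne_zero {q : ℕ} (hq : q ≠ 0) {g : PowerSeries K} (hg : g ≠ 0) :
    ∃ r < q, cartier q r g ≠ 0 := by
  by_contra! h
  apply hg
  rw [← sum_X_pow_mul_expand_cartier hq g]
  exact Finset.sum_eq_zero fun r hr => by rw [h r (Finset.mem_range.1 hr)]; simp

/-- Cartier operators preserve polynomials and divide degrees by `q`. -/
theorem exists_coe_eq_cartier {q : ℕ} (hq : q ≠ 0) (r : ℕ) (p : K[X]) :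
    ∃ p' : K[X], p'.natDegree ≤ p.natDegree / q ∧
      (p' : PowerSeries K) = cartier q r (p : PowerSeries K) := by
  refine ⟨PowerSeries.trunc (p.natDegree / q + 1) (cartier q r p), ?_, ?_⟩
  · exact Nat.lt_succ_iff.1 (PowerSeries.natDegree_trunc_lt _ _)
  · ext i
    rw [Polynomial.coeff_coe, PowerSeries.coeff_trunc, coeff_cartier, Polynomial.coeff_coe]
    split_ifs with h
    · rfl
    · refine (Polynomial.coeff_eq_zero_of_natDegree_lt ?_).symm
      have h1 : p.natDegree / q < i := by omega
      have := (Nat.div_lt_iff_lt_mul (Nat.pos_of_ne_zero hq)).1 h1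
      rw [mul_comm] at this
      omega

theorem cartier_cartier (q r q' r' : ℕ) (g : PowerSeries K) :
    cartier q r (cartier q' r' g) = cartier (q' * q) (q' * r + r') g := by
  ext i
  simp only [coeff_cartier]
  rw [show q' * (q * i + r) + r' = q' * q * i + (q' * r + r') by ring]

/-! ### The powers of the Mahler operator on power series -/

/-- The action `f(z) ↦ f(z^{k^i})` of `Δ_k^i` on power series. -/
def shift (k : ℕ) (hk : 2 ≤ k) (i : ℕ) : PowerSeries K →ₐ[K] PowerSeries K :=
  PowerSeries.expand (k ^ i) (pow_ne_zero i (by omega))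

theorem shift_coe (k : ℕ) (hk : 2 ≤ k) (i : ℕ) (p : K[X]) :
    shift k hk i (p : PowerSeries K) = (Polynomial.expand K (k ^ i) p : K[X]) := by
  ext j
  rw [shift, PowerSeries.coeff_expand, Polynomial.coeff_coe, Polynomial.coeff_coe,
    Polynomial.coeff_expand (by positivity)]

theorem shift_shift (k : ℕ) (hk : 2 ≤ k) (i j : ℕ) (g : PowerSeries K) :
    shift k hk i (shift k hk j g) = shift k hk (i + j) g := by
  have := PowerSeries.expand_mul (k ^ i) (pow_ne_zero i (by omega)) (k ^ j)
    (pow_ne_zero j (by omega)) g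
  simp only [shift, pow_add]
  rw [this]

@[simp]
theorem shift_zero (k : ℕ) (hk : 2 ≤ k) (g : PowerSeries K) : shift k hk 0 g = g := by
  simp [shift]

theorem cartier_mul_shift {k : ℕ} (hk : 2 ≤ k) {i j r : ℕ} (hr : r < k ^ i) (a g : PowerSeries K) :
    cartier (k ^ i) r (a * shift k hk (i + j) g) = cartier (k ^ i) r a * shift k hk j g := by
  rw [← shift_shift]
  exact cartier_mul_expand _ hr _ _

/-! ### Clearing denominators -/

theorem algebraMap_denom_mul (c : RatFunc K) :
    algebraMap K[X] (RatFunc K) c.denom * c = algebraMap K[X] (RatFunc K) c.num := by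
  have : algebraMap K[X] (RatFunc K) c.denom ≠ 0 := RatFunc.algebraMap_ne_zero c.denom_ne_zero
  nth_rewrite 2 [← RatFunc.num_div_denom c]
  field_simp

/-- The product of the denominators is a common denominator. -/
theorem exists_common_denom (s : Finset ℕ) (c : ℕ → RatFunc K) :
    ∃ a : ℕ → K[X], ∀ i ∈ s, algebraMap K[X] (RatFunc K) (∏ j ∈ s, (c j).denom) * c i
      = algebraMap K[X] (RatFunc K) (a i) := by
  classical
  refine ⟨fun i => (∏ j ∈ s.erase i, (c j).denom) * (c i).num, fun i hi => ?_⟩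
  rw [← Finset.mul_prod_erase s _ hi]
  rw [map_mul, map_mul, ← algebraMap_denom_mul (c i)]
  ring

theorem coe_laurent_injective :
    Function.Injective (fun g : PowerSeries K => (g : K⸨X⸩)) :=
  HahnSeries.ofPowerSeries_injective

/-- A linear relation over `K(z)` between power series, with denominators cleared. -/
theorem laurent_eq_sum_iff {s : Finset ℕ} {c : ℕ → RatFunc K} {a : ℕ → K[X]} {b : K[X]} (hb : b ≠ 0)
    (h : ∀ i ∈ s, algebraMap K[X] (RatFunc K) b * c i = algebraMap K[X] (RatFunc K) (a i))
    (f : PowerSeries K) (g : ℕ → PowerSeries K) :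
    (f : K⸨X⸩) = ∑ i ∈ s, algebraMap (RatFunc K) K⸨X⸩ (c i) * (g i : K⸨X⸩) ↔
      (b : PowerSeries K) * f = ∑ i ∈ s, (a i : PowerSeries K) * g i := by
  have hcoe : ∀ p : K[X], ((p : PowerSeries K) : K⸨X⸩)
      = algebraMap (RatFunc K) K⸨X⸩ (algebraMap K[X] (RatFunc K) p) := fun p =>
    RatFunc.coe_coe p
  have hb' : ((b : PowerSeries K) : K⸨X⸩) ≠ 0 := by
    rw [hcoe]
    simpa using hb
  rw [← coe_laurent_injective.eq_iff, ← mul_right_inj' hb', Finset.mul_sum]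
  simp only [map_mul, map_sum]
  refine Eq.congr_right (Finset.sum_congr rfl fun i hi => ?_)
  rw [hcoe (a i), ← h i hi, map_mul, hcoe b, mul_assoc]

theorem sum_Icc_eq_sum_range {M : Type*} [AddCommMonoid M] (m n : ℕ) (g : ℕ → M) :
    ∑ i ∈ Finset.Icc (m + 1) (m + n), g i = ∑ i ∈ Finset.range n, g (m + 1 + i) := by
  rw [← Finset.Ico_succ_right_eq_Icc, Finset.sum_Ico_eq_sum_range]
  congr 2
  simp

/-! ### Poles -/

theorem valAt_eq_one_iff (α : K) (p : K[X]) :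
    valAt α (algebraMap K[X] (RatFunc K) p) = 1 ↔ p.eval α ≠ 0 := by
  rw [valAt, IsDedekindDomain.HeightOneSpectrum.valuation_eq_one_iff_notMem]
  simp [primeAt, Ideal.mem_span_singleton, dvd_iff_isRoot]

theorem noPoleAt_of_mul_eq {α : K} {c : RatFunc K} {a b : K[X]} (hb : b.eval α ≠ 0)
    (h : algebraMap K[X] (RatFunc K) b * c = algebraMap K[X] (RatFunc K) a) : NoPoleAt α c := by
  have h1 := congrArg (valAt α) h
  rw [map_mul, (valAt_eq_one_iff α b).2 hb, one_mul] at h1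
  rw [NoPoleAt, h1]
  exact IsDedekindDomain.HeightOneSpectrum.valuation_le_one _ _

theorem noPoleAt_iff (α : K) (c : RatFunc K) : NoPoleAt α c ↔ c.denom.eval α ≠ 0 := by
  have hd := algebraMap_denom_mul c
  refine ⟨fun h h0 => ?_, fun h => noPoleAt_of_mul_eq h hd⟩
  have hnum : c.num.eval α ≠ 0 := by
    intro hn
    obtain ⟨u, v, huv⟩ := c.isCoprime_num_denom
    have := congrArg (Polynomial.eval α) huv
    simp [hn, h0] at this
  have h1 := congrArg (valAt α) hd
  rw [map_mul, (valAt_eq_one_iff α c.num).2 hnum] at h1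
  have h2 : valAt α (algebraMap K[X] (RatFunc K) c.denom) < 1 :=
    lt_of_le_of_ne (IsDedekindDomain.HeightOneSpectrum.valuation_le_one _ _)
      fun he => (valAt_eq_one_iff α c.denom).1 he h0
  have h3 := mul_lt_one_of_lt_of_le h2 h
  exact absurd h1 h3.ne

/-! ### Mahler equations with polynomial coefficients -/

/-- A Mahler equation with denominators cleared, in `K[[z]]`. -/
theorem satisfiesMahlerEq_iff {k : ℕ} {hk : 2 ≤ k} {f : PowerSeries K} {n : ℕ} {c : ℕ → RatFunc K}
    {a : ℕ → K[X]} {b : K[X]} (hb : b ≠ 0)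
    (h : ∀ i ∈ Finset.Icc 1 n,
      algebraMap K[X] (RatFunc K) b * c i = algebraMap K[X] (RatFunc K) (a i)) :
    SatisfiesMahlerEq k hk f n c ↔
      (b : PowerSeries K) * f = ∑ i ∈ Finset.Icc 1 n, (a i : PowerSeries K) * shift k hk i f :=
  laurent_eq_sum_iff hb h f fun i => shift k hk i f

theorem prod_denom_ne_zero (s : Finset ℕ) (c : ℕ → RatFunc K) : ∏ j ∈ s, (c j).denom ≠ 0 :=
  Finset.prod_ne_zero_iff.2 fun j _ => (c j).denom_ne_zero

theorem satisfiesMahlerEq_div {k : ℕ} {hk : 2 ≤ k} {f : PowerSeries K} {n : ℕ}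
    {a : ℕ → K[X]} {b : K[X]} (hb : b ≠ 0)
    (h : (b : PowerSeries K) * f
      = ∑ i ∈ Finset.Icc 1 n, (a i : PowerSeries K) * shift k hk i f) :
    SatisfiesMahlerEq k hk f n
      fun i => algebraMap K[X] (RatFunc K) (a i) / algebraMap K[X] (RatFunc K) b := by
  refine (satisfiesMahlerEq_iff hb fun i _ => ?_).2 h
  have := RatFunc.algebraMap_ne_zero hb
  field_simp

/-- If `f` satisfies no Mahler equation of order less than `n`, then any `n` consecutive shifts of
`f` are linearly independent over `K[z]`: a Cartier operator turns a relation between them into one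
in which `f` itself occurs. -/
theorem eq_zero_of_sum_mul_shift_eq_zero {k : ℕ} {hk : 2 ≤ k} {f : PowerSeries K} {n : ℕ}
    (hmin : ∀ n' < n, ¬ ∃ c' : ℕ → RatFunc K, SatisfiesMahlerEq k hk f n' c')
    (j : ℕ) (b : ℕ → K[X])
    (h : ∑ i ∈ Finset.range n, (b i : PowerSeries K) * shift k hk (j + i) f = 0) :
    ∀ i < n, b i = 0 := by
  classical
  by_contra! hex
  obtain ⟨hi₀n, hi₀⟩ := Nat.find_spec hex
  have hlt : ∀ i < Nat.find hex, b i = 0 := fun i hi => by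
    by_contra hne
    exact Nat.find_min hex hi ⟨hi.trans hi₀n, hne⟩
  generalize Nat.find hex = i₀ at hi₀n hi₀ hlt
  have hq : k ^ (j + i₀) ≠ 0 := pow_ne_zero _ (by omega)
  obtain ⟨r, hr, hne⟩ := exists_cartier_ne_zero hq (g := (b i₀ : PowerSeries K))
    (by simpa using hi₀)
  obtain ⟨t, rfl⟩ := Nat.exists_eq_add_of_le (Nat.succ_le_of_lt hi₀n)
  -- the transformed relation starts at `f` itself, with the nonzero coefficient `p i₀`
  choose p _ hp using fun i => exists_coe_eq_cartier hq r (b i)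
  rw [show i₀.succ + t = i₀ + (t + 1) by omega, Finset.sum_range_add, Finset.sum_eq_zero, zero_add]
    at h
  swap
  · intro i hi
    rw [hlt i (Finset.mem_range.1 hi)]
    simp
  have h2 := congrArg (cartier (k ^ (j + i₀)) r) h
  rw [map_zero, map_sum] at h2
  simp only [← add_assoc, cartier_mul_shift hk hr, ← hp] at h2
  rw [Finset.sum_range_succ', add_zero, shift_zero] at h2
  have hp₀ : p i₀ ≠ 0 := by
    intro h0
    rw [← hp, h0] at hne
    simp at hne
  refine hmin t (by omega) ⟨_, satisfiesMahlerEq_div (a := fun i => -p (i₀ + i)) hp₀ ?_⟩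
  have hr := sum_Icc_eq_sum_range 0 t fun i =>
    ((-p (i₀ + i) : K[X]) : PowerSeries K) * shift k hk i f
  simp only [zero_add] at hr
  rw [hr, eq_neg_of_add_eq_zero_right h2, ← Finset.sum_neg_distrib]
  refine Finset.sum_congr rfl fun i _ => ?_
  rw [Polynomial.coe_neg, neg_mul, add_comm 1 i]

/-! ### The special operators -/

theorem substPow_algebraMap (k : ℕ) (hk : 2 ≤ k) (p : K[X]) :
    substPow k hk (algebraMap K[X] (RatFunc K) p)
      = algebraMap K[X] (RatFunc K) (Polynomial.expand K k p) := by
  have h := RatFunc.map_apply_div_ne_zero (Polynomial.expand K k)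
    (nonZeroDivisors_le_comap_nonZeroDivisors_of_injective _
      (Polynomial.expand_injective (R := K) (by omega : 0 < k))) p 1 one_ne_zero
  simpa [substPow, RatFunc.coe_mapRingHom_eq_coe_map] using h

theorem substPow_pow_algebraMap (k : ℕ) (hk : 2 ≤ k) (m : ℕ) (p : K[X]) :
    (substPow k hk ^ m) (algebraMap K[X] (RatFunc K) p)
      = algebraMap K[X] (RatFunc K) (Polynomial.expand K (k ^ m) p) := by
  induction m with
  | zero => simp
  | succ m ih =>
    rw [pow_succ', RingHom.mul_def, RingHom.comp_apply, ih, substPow_algebraMap, pow_succ',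
      Polynomial.expand_mul]

/-- Applying `Δ_k^m` to a Mahler equation. -/
theorem SatisfiesMahlerEq.shift_eq {k : ℕ} {hk : 2 ≤ k} {f : PowerSeries K} {n : ℕ}
    {c : ℕ → RatFunc K} (hf : SatisfiesMahlerEq k hk f n c) (m : ℕ) :
    (shift k hk m f : K⸨X⸩) = ∑ i ∈ Finset.Icc 1 n,
      algebraMap (RatFunc K) K⸨X⸩ ((substPow k hk ^ m) (c i)) * (shift k hk (m + i) f : K⸨X⸩) := by
  obtain ⟨a, ha⟩ := exists_common_denom (Finset.Icc 1 n) c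
  have hb := prod_denom_ne_zero (Finset.Icc 1 n) c
  generalize ∏ j ∈ Finset.Icc 1 n, (c j).denom = b at ha hb
  have h1 := congrArg (shift k hk m) ((satisfiesMahlerEq_iff hb ha).1 hf)
  simp only [map_mul, map_sum, shift_coe, shift_shift] at h1
  refine (laurent_eq_sum_iff (a := fun i => Polynomial.expand K (k ^ m) (a i))
    (b := Polynomial.expand K (k ^ m) b) ?_ (fun i hi => ?_) _ _).2 h1
  · simpa [Polynomial.expand_eq_zero (show 0 < k ^ m by positivity)] using hb
  · have h2 := congrArg (substPow k hk ^ m) (ha i hi)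
    rwa [map_mul, substPow_pow_algebraMap, substPow_pow_algebraMap] at h2

theorem coeff_sum_monomial (s n : ℕ) (c : ℕ → RatFunc K) (i : ℕ) :
    (∑ j ∈ Finset.Icc 1 n, SkewPolynomial.monomial (s + j) (c j)).coeff i
      = if s + 1 ≤ i ∧ i ≤ s + n then c (i - s) else 0 := by
  induction n with
  | zero =>
    rw [if_neg (by omega)]
    simp
  | succ n ih =>
    rw [Finset.sum_Icc_succ_top (by omega), SkewPolynomial.coeff_add, ih,
      SkewPolynomial.coeff_monomial]
    by_cases h : s + (n + 1) = i
    · subst h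
      rw [if_neg (by omega), if_pos rfl, if_pos (by omega), zero_add, Nat.add_sub_cancel_left]
    · rw [if_neg h, add_zero]
      exact if_congr (by omega) rfl rfl

theorem gammaCoeff_zero (k : ℕ) (hk : 2 ≤ k) (n : ℕ) (c ψ : ℕ → RatFunc K) {i : ℕ} (hi : 1 ≤ i) :
    gammaCoeff k hk n c ψ i 0 = if i ≤ n then c i else 0 := by
  let _ := mahlerAction K k hk
  have h : gammaOp k hk n c ψ 0 = equationOp n c := by
    simp [gammaOp, multiplierOp]
  have h2 := coeff_sum_monomial 0 n c i
  simp only [zero_add] at h2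
  rw [gammaCoeff, h, equationOp, SkewPolynomial.coeff_sub, h2, SkewPolynomial.coeff_one,
    if_neg (by omega), zero_sub, neg_neg]
  exact if_congr (by omega) rfl rfl

/-- The recursion for the coefficients of `Γ_m(ψ) = Γ_{m-1}(ψ) + ψ_m Δ_k^m (1 - ∑ c_i Δ_k^i)`. -/
theorem gammaCoeff_succ (k : ℕ) (hk : 2 ≤ k) (n : ℕ) (c ψ : ℕ → RatFunc K) (i m : ℕ) :
    gammaCoeff k hk n c ψ i (m + 1) = gammaCoeff k hk n c ψ i m
      - (if i = m + 1 then ψ (m + 1) else 0)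
      + (if m + 2 ≤ i ∧ i ≤ m + 1 + n then
          ψ (m + 1) * (substPow k hk ^ (m + 1)) (c (i - (m + 1))) else 0) := by
  let _ := mahlerAction K k hk
  have h : gammaOp k hk n c ψ (m + 1) = gammaOp k hk n c ψ m
      + SkewPolynomial.monomial (m + 1) (ψ (m + 1)) * equationOp n c := by
    simp only [gammaOp, multiplierOp]
    rw [Finset.sum_Icc_succ_top (by omega), ← add_assoc, add_mul _ _ (equationOp n c)]
  have h2 : SkewPolynomial.monomial (m + 1) (ψ (m + 1)) * equationOp n c
      = SkewPolynomial.monomial (m + 1) (ψ (m + 1)) - ∑ j ∈ Finset.Icc 1 n,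
        SkewPolynomial.monomial (m + 1 + j) (ψ (m + 1) * (substPow k hk ^ (m + 1)) (c j)) := by
    rw [equationOp, mul_sub, mul_one, Finset.mul_sum]
    congr 1
    refine Finset.sum_congr rfl fun j _ => ?_
    rw [SkewPolynomial.monomial_mul_monomial]
    rfl
  rw [gammaCoeff, gammaCoeff, h, h2, SkewPolynomial.coeff_add, SkewPolynomial.coeff_sub,
    coeff_sum_monomial, SkewPolynomial.coeff_monomial]
  simp only [eq_comm (a := i)]
  rw [neg_add, neg_sub, sub_eq_add_neg, add_comm _ (-_), ← add_assoc, ← sub_eq_add_neg]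

theorem gammaCoeff_eq_zero (k : ℕ) (hk : 2 ≤ k) (n : ℕ) (c ψ : ℕ → RatFunc K) {i m : ℕ}
    (hi : m + n < i) : gammaCoeff k hk n c ψ i m = 0 := by
  induction m with
  | zero => rw [gammaCoeff_zero _ _ _ _ _ (by omega), if_neg (by omega)]
  | succ m ih =>
    rw [gammaCoeff_succ, ih (by omega), if_neg (by omega), if_neg (by omega)]
    simp

/-- Each special operator annihilates `f` and has no terms of order `1, …, m`: it expresses `f` in
terms of `Δ_k^{m+1} f, …, Δ_k^{m+n} f`. -/
theorem SatisfiesMahlerEq.eq_sum_specialCoeff {k : ℕ} {hk : 2 ≤ k} {f : PowerSeries K} {n : ℕ}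
    {c : ℕ → RatFunc K} (hf : SatisfiesMahlerEq k hk f n c) (m : ℕ) :
    (f : K⸨X⸩) = ∑ i ∈ Finset.Icc (m + 1) (m + n),
      algebraMap (RatFunc K) K⸨X⸩ (specialCoeff k hk n c i m) * (shift k hk i f : K⸨X⸩) := by
  rcases Nat.eq_zero_or_pos n with rfl | hn
  · simpa [SatisfiesMahlerEq] using hf
  obtain ⟨n, rfl⟩ := Nat.exists_eq_add_of_lt hn
  simp only [zero_add] at *
  induction m with
  | zero =>
    rw [zero_add, zero_add]
    refine hf.trans (Finset.sum_congr rfl fun i hi => ?_)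
    rw [Finset.mem_Icc] at hi
    rw [specialCoeff, gammaCoeff_zero _ _ _ _ _ hi.1, if_pos hi.2]
    rfl
  | succ m ih =>
    have hψ : specialPsi k hk (n + 1) c (m + 1) = specialCoeff k hk (n + 1) c (m + 1) m :=
      specialPsi_eq k hk (n + 1) c (m + 1) (by omega)
    have hd : ∀ i ∈ Finset.range (n + 1), specialCoeff k hk (n + 1) c (m + 1 + 1 + i) (m + 1)
        = specialCoeff k hk (n + 1) c (m + 1 + 1 + i) m + specialCoeff k hk (n + 1) c (m + 1) m *
          (substPow k hk ^ (m + 1)) (c (0 + 1 + i)) := by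
      intro i hi
      rw [Finset.mem_range] at hi
      rw [specialCoeff, gammaCoeff_succ, if_neg (by omega), sub_zero, if_pos (by omega), hψ,
        show m + 1 + 1 + i - (m + 1) = 0 + 1 + i by omega]
      rfl
    have hs := hf.shift_eq (m + 1)
    have hr := sum_Icc_eq_sum_range 0 (n + 1) fun i =>
      algebraMap (RatFunc K) K⸨X⸩ ((substPow k hk ^ (m + 1)) (c i))
        * (shift k hk (m + 1 + i) f : K⸨X⸩)
    rw [zero_add, zero_add] at hr
    rw [hr] at hs
    rw [sum_Icc_eq_sum_range, Finset.sum_range_succ'] at ih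
    rw [sum_Icc_eq_sum_range, Finset.sum_congr rfl fun i hi => by rw [hd i hi, map_add, map_mul]]
    simp only [add_mul, Finset.sum_add_distrib]
    rw [Finset.sum_range_succ]
    have h0 : specialCoeff k hk (n + 1) c (m + 1 + 1 + n) m = 0 :=
      gammaCoeff_eq_zero _ _ _ _ _ (by omega)
    rw [h0, map_zero, zero_mul, add_zero]
    nth_rewrite 1 [ih]
    rw [add_zero, hs, Finset.mul_sum]
    refine congrArg₂ (· + ·) ?_ ?_
    · refine Finset.sum_congr rfl fun i _ => ?_
      rw [show m + 1 + (i + 1) = m + 1 + 1 + i by omega]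
    · refine Finset.sum_congr rfl fun i _ => ?_
      rw [show m + 1 + (0 + 1 + i) = m + 1 + 1 + i by omega, mul_assoc]

theorem polynomial_smul_eq (p : K[X]) (g : PowerSeries K) : p • g = (p : PowerSeries K) * g := by
  rw [Algebra.smul_def, PowerSeries.algebraMap_apply']
  simp

/-! ### From regularity to the special operators -/

/-- The `K[z]`-span of `f, Δ_k f, …, Δ_k^{n-1} f`. -/
def shiftSpan (k : ℕ) (hk : 2 ≤ k) (n : ℕ) (f : PowerSeries K) : Submodule K[X] (PowerSeries K) :=
  Submodule.span K[X] ((fun i => shift k hk i f) '' (Finset.range n : Set ℕ))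

theorem mem_shiftSpan_iff {k : ℕ} {hk : 2 ≤ k} {n : ℕ} {f g : PowerSeries K} :
    g ∈ shiftSpan k hk n f ↔
      ∃ a : ℕ → K[X], g = ∑ i ∈ Finset.range n, (a i : PowerSeries K) * shift k hk i f := by
  rw [shiftSpan, Submodule.mem_span_image_finset_iff_exists_fun']
  simp only [polynomial_smul_eq]
  exact exists_congr fun a => eq_comm

/-- Every denominator divides one that is a polynomial in `z^q`, since
`z - β` divides `z^q - β^q`. -/
theorem exists_dvd_expand [IsAlgClosed K] {q : ℕ} {p : K[X]} (hp : p ≠ 0) :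
    ∃ p' : K[X], p' ≠ 0 ∧ p ∣ Polynomial.expand K q p' := by
  refine ⟨(p.roots.map fun β => X - C (β ^ q)).prod, ?_, ?_⟩
  · exact (monic_multiset_prod_of_monic _ _ fun β _ => monic_X_sub_C (β ^ q)).ne_zero
  · have h := (IsAlgClosed.splits p).eq_prod_roots
    rw [h, map_multiset_prod, Multiset.map_map]
    rw [(isUnit_C.2 (leadingCoeff_ne_zero.2 hp).isUnit).mul_left_dvd, ← h]
    refine Multiset.prod_dvd_prod_of_dvd _ _ fun β _ => ?_
    simpa using sub_dvd_pow_sub_pow X (C β) q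

/-- `f` is a `K(z)`-combination of any `n` consecutive `Δ_k^i f`, `i ≥ e`. -/
theorem SatisfiesMahlerEq.exists_eq_sum_shift {k : ℕ} {hk : 2 ≤ k} {f : PowerSeries K} {n : ℕ}
    {c : ℕ → RatFunc K} (hf : SatisfiesMahlerEq k hk f n c) (e : ℕ) :
    ∃ (b : K[X]) (a : ℕ → K[X]), b ≠ 0 ∧ (b : PowerSeries K) * f
      = ∑ i ∈ Finset.range n, (a i : PowerSeries K) * shift k hk (e + i) f := by
  cases e with
  | zero =>
    rcases Nat.eq_zero_or_pos n with rfl | hn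
    · have h := (satisfiesMahlerEq_iff (a := 0) one_ne_zero (by simp)).1 hf
      exact ⟨1, 0, one_ne_zero, by simpa using h⟩
    · refine ⟨1, fun i => if i = 0 then 1 else 0, one_ne_zero, ?_⟩
      rw [Finset.sum_eq_single_of_mem 0 (Finset.mem_range.2 hn)]
      · simp
      · intro i _ hi
        simp [hi]
  | succ m =>
    obtain ⟨a, ha⟩ := exists_common_denom (Finset.Icc (m + 1) (m + n))
      fun i => specialCoeff k hk n c i m
    have hb := prod_denom_ne_zero (Finset.Icc (m + 1) (m + n)) fun i => specialCoeff k hk n c i m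
    refine ⟨_, fun i => a (m + 1 + i), hb, ?_⟩
    have h := (laurent_eq_sum_iff hb ha f fun i => shift k hk i f).1 (hf.eq_sum_specialCoeff m)
    rw [h, sum_Icc_eq_sum_range]

/-- Every Cartier transform of `f` lies in the `K(z)`-span of `f, Δ_k f, …, Δ_k^{n-1} f`. -/
theorem SatisfiesMahlerEq.exists_smul_cartier_mem [IsAlgClosed K] {k : ℕ} {hk : 2 ≤ k}
    {f : PowerSeries K} {n : ℕ} {c : ℕ → RatFunc K} (hf : SatisfiesMahlerEq k hk f n c)
    {e r : ℕ} (hr : r < k ^ e) :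
    ∃ P : K[X], P ≠ 0 ∧ P • cartier (k ^ e) r f ∈ shiftSpan k hk n f := by
  obtain ⟨b, a, hb, h⟩ := hf.exists_eq_sum_shift e
  obtain ⟨P, hP, t, ht⟩ := exists_dvd_expand (q := k ^ e) hb
  refine ⟨P, hP, mem_shiftSpan_iff.2 ?_⟩
  have hq : k ^ e ≠ 0 := pow_ne_zero _ (by omega)
  choose p _ hp using fun i => exists_coe_eq_cartier hq r (t * a i)
  refine ⟨p, ?_⟩
  have h1 : (f : PowerSeries K) * shift k hk e P
      = ∑ i ∈ Finset.range n, ((t * a i : K[X]) : PowerSeries K) * shift k hk (e + i) f := by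
    rw [shift_coe, ht, mul_comm, Polynomial.coe_mul, mul_comm (b : PowerSeries K), mul_assoc, h,
      Finset.mul_sum]
    simp only [Polynomial.coe_mul, mul_assoc]
  have h2 := congrArg (cartier (k ^ e) r) h1
  have h3 := cartier_mul_shift hk hr f (j := 0) P
  rw [add_zero, shift_zero] at h3
  rw [map_sum, h3] at h2
  simp only [cartier_mul_shift hk hr, ← hp] at h2
  rw [polynomial_smul_eq, mul_comm, h2]

theorem mk_kernel_eq_cartier (q r : ℕ) (f : PowerSeries K) :
    (PowerSeries.mk fun i => PowerSeries.coeff (q * i + r) f) = cartier q r f := rfl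

/-- For regular `f` the denominators in `exists_smul_cartier_mem` can be chosen uniformly. -/
theorem exists_uniform_denom [IsAlgClosed K] {k : ℕ} {hk : 2 ≤ k}
    {f : PowerSeries K} {n : ℕ} {c : ℕ → RatFunc K} (hf : SatisfiesMahlerEq k hk f n c)
    (hreg : IsRegularSeries k f) :
    ∃ P : K[X], P ≠ 0 ∧ ∀ e r, r < k ^ e → P • cartier (k ^ e) r f ∈ shiftSpan k hk n f := by
  classical
  have hfg : (Submodule.span K (kKernel k fun i => PowerSeries.coeff i f)).FG :=
    Module.Finite.iff_fg.1 hreg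
  obtain ⟨t, ht, hspan⟩ := Submodule.fg_span_iff_fg_span_finset_subset _ |>.1 hfg
  have hex : ∀ b ∈ t, ∃ P : K[X], P ≠ 0 ∧ P • PowerSeries.mk b ∈ shiftSpan k hk n f := by
    intro b hb
    obtain ⟨e, r, hr, rfl⟩ := ht hb
    exact hf.exists_smul_cartier_mem hr
  choose! P hP hmem using hex
  refine ⟨∏ b ∈ t, P b, Finset.prod_ne_zero_iff.2 hP, fun e r hr => ?_⟩
  have hmem_span : (fun i => PowerSeries.coeff (k ^ e * i + r) f)
      ∈ Submodule.span K (t : Set (ℕ → K)) :=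
    hspan ▸ Submodule.subset_span ⟨e, r, hr, rfl⟩
  rw [← mk_kernel_eq_cartier]
  generalize (fun i => PowerSeries.coeff (k ^ e * i + r) f) = b at hmem_span
  induction hmem_span using Submodule.span_induction with
  | mem b hb =>
    rw [← Finset.prod_erase_mul t _ hb, mul_smul]
    exact Submodule.smul_mem _ _ (hmem b hb)
  | zero =>
    have : PowerSeries.mk (0 : ℕ → K) = 0 := rfl
    simp [this]
  | add x y _ _ hx hy =>
    have : PowerSeries.mk (x + y) = PowerSeries.mk x + PowerSeries.mk y := rfl
    rw [this, smul_add]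
    exact add_mem hx hy
  | smul a x _ hx =>
    have : PowerSeries.mk (a • x) = (C a : K[X]) • PowerSeries.mk x := by
      ext i
      simp [polynomial_smul_eq]
    rw [this, smul_comm]
    exact Submodule.smul_mem _ _ hx

/-- If `P` is a common denominator for the Cartier transforms of `f`, then `d_{i,m}` can have a pole
at `α` only if `P` vanishes at `α^{k^{m+1}}`. -/
theorem noPoleAt_specialCoeff [IsAlgClosed K] {k : ℕ} {hk : 2 ≤ k}
    {f : PowerSeries K} {n : ℕ} {c : ℕ → RatFunc K} (hf : SatisfiesMahlerEq k hk f n c)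
    (hmin : ∀ n' < n, ¬ ∃ c' : ℕ → RatFunc K, SatisfiesMahlerEq k hk f n' c')
    {P : K[X]} (hP : ∀ e r, r < k ^ e → P • cartier (k ^ e) r f ∈ shiftSpan k hk n f)
    {α : K} {m : ℕ} (hα : P.eval (α ^ k ^ (m + 1)) ≠ 0) {i : ℕ} (h1 : m + 1 ≤ i) (h2 : i ≤ m + n) :
    NoPoleAt α (specialCoeff k hk n c i m) := by
  have hq : k ^ (m + 1) ≠ 0 := pow_ne_zero _ (by omega)
  -- a second expression for `f` in terms of `Δ_k^{m+1} f, …, Δ_k^{m+n} f`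
  have hA : ∃ A : ℕ → K[X], (Polynomial.expand K (k ^ (m + 1)) P : PowerSeries K) * f
      = ∑ j ∈ Finset.range n, (A j : PowerSeries K) * shift k hk (m + 1 + j) f := by
    have hP' : ∀ r, ∃ a : ℕ → K[X], r < k ^ (m + 1) →
        (P : PowerSeries K) * cartier (k ^ (m + 1)) r f
          = ∑ j ∈ Finset.range n, (a j : PowerSeries K) * shift k hk j f := fun r => by
      by_cases hr : r < k ^ (m + 1)
      · obtain ⟨a, ha⟩ := mem_shiftSpan_iff.1 (hP (m + 1) r hr)
        exact ⟨a, fun _ => by rw [← ha, polynomial_smul_eq]⟩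
      · exact ⟨0, fun h => absurd h hr⟩
    choose a ha using hP'
    refine ⟨fun j => ∑ r ∈ Finset.range (k ^ (m + 1)),
      X ^ r * Polynomial.expand K (k ^ (m + 1)) (a r j), ?_⟩
    nth_rewrite 1 [← sum_X_pow_mul_expand_cartier hq f]
    have hterm : ∀ r ∈ Finset.range (k ^ (m + 1)),
        (Polynomial.expand K (k ^ (m + 1)) P : PowerSeries K) *
          (PowerSeries.X ^ r * PowerSeries.expand (k ^ (m + 1)) hq (cartier (k ^ (m + 1)) r f))
        = ∑ j ∈ Finset.range n, PowerSeries.X ^ r *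
          ((Polynomial.expand K (k ^ (m + 1)) (a r j) : PowerSeries K)
            * shift k hk (m + 1 + j) f) := by
      intro r hr
      have h3 := congrArg (shift k hk (m + 1)) (ha r (Finset.mem_range.1 hr))
      simp only [map_mul, map_sum, shift_coe, shift_shift] at h3
      rw [← Finset.mul_sum, ← h3]
      simp only [shift]
      ring
    rw [Finset.mul_sum, Finset.sum_congr rfl hterm, Finset.sum_comm]
    refine Finset.sum_congr rfl fun j _ => ?_
    rw [← Polynomial.coeToPowerSeries.ringHom_apply, map_sum, Finset.sum_mul]
    refine Finset.sum_congr rfl fun r _ => ?_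
    simp [mul_assoc]
  obtain ⟨A, hA⟩ := hA
  obtain ⟨a, ha⟩ := exists_common_denom (Finset.Icc (m + 1) (m + n))
    fun i => specialCoeff k hk n c i m
  have hb := prod_denom_ne_zero (Finset.Icc (m + 1) (m + n)) fun i => specialCoeff k hk n c i m
  generalize ∏ j ∈ Finset.Icc (m + 1) (m + n), (specialCoeff k hk n c j m).denom = b at ha hb
  have h := (laurent_eq_sum_iff hb ha f fun i => shift k hk i f).1 (hf.eq_sum_specialCoeff m)
  rw [sum_Icc_eq_sum_range] at h
  -- the two expressions have proportional coefficients
  have h0 := eq_zero_of_sum_mul_shift_eq_zero hmin (m + 1)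
    (fun j => Polynomial.expand K (k ^ (m + 1)) P * a (m + 1 + j) - b * A j) (by
      simp only [Polynomial.coe_sub, Polynomial.coe_mul, sub_mul, mul_assoc, Finset.sum_sub_distrib]
      rw [← Finset.mul_sum, ← Finset.mul_sum, ← h, ← hA]
      ring) (i - (m + 1)) (by omega)
  rw [show m + 1 + (i - (m + 1)) = i by omega, sub_eq_zero] at h0
  refine noPoleAt_of_mul_eq (b := Polynomial.expand K (k ^ (m + 1)) P) (a := A (i - (m + 1)))
    (by rwa [Polynomial.expand_eval]) ?_
  apply mul_left_cancel₀ (RatFunc.algebraMap_ne_zero hb)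
  rw [mul_left_comm, ha i (Finset.mem_Icc.2 ⟨h1, h2⟩), ← map_mul, ← map_mul, h0]

/-- The orbit of a number that is neither zero nor a root of unity eventually leaves the zeros of a
polynomial. -/
theorem exists_forall_eval_pow_ne_zero {k : ℕ} (hk : 2 ≤ k) {α : K} (h0 : α ≠ 0)
    (hα : ¬ IsOfFinOrder α) {R : K[X]} (hR : R ≠ 0) :
    ∃ m, ∀ j > m, R.eval (α ^ k ^ j) ≠ 0 := by
  have hinj : Function.Injective fun j : ℕ => α ^ k ^ j := by
    have hlt : ∀ a b : ℕ, a < b → α ^ a ≠ α ^ b := by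
      intro a b hab he
      obtain ⟨d, rfl⟩ := Nat.exists_eq_add_of_lt hab
      rw [add_assoc, pow_add] at he
      refine hα (isOfFinOrder_iff_pow_eq_one.2 ⟨d + 1, by omega, ?_⟩)
      exact (mul_left_cancel₀ (pow_ne_zero a h0) ((mul_one _).trans he)).symm
    intro i j hij
    by_contra hne
    rcases lt_or_gt_of_ne hne with h | h
    · exact hlt _ _ (Nat.pow_lt_pow_right (by omega) h) hij
    · exact hlt _ _ (Nat.pow_lt_pow_right (by omega) h) hij.symm
  have hfin : {j : ℕ | R.eval (α ^ k ^ j) = 0}.Finite :=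
    (R.rootSet_finite K |>.preimage hinj.injOn).subset fun j hj => by
      simpa [Polynomial.mem_rootSet, hR] using hj
  obtain ⟨m, hm⟩ := hfin.bddAbove
  exact ⟨m, fun j hj h => absurd (hm h) (by omega)⟩

theorem IsAnxious.ne_zero {k : ℕ} {α : K} (h : IsAnxious k α) : α ≠ 0 := fun h0 => h (Or.inl h0)

/-! ### From the special operators to a calm equation -/

/-- If, for each anxious `α`, some multiple of `f` by a polynomial not vanishing at `α` is a
`K[z]`-combination of `Δ_k f, Δ_k^2 f, …`, then `f` satisfies a calm Mahler equation: the
polynomials `p` with `p f` in that span form an ideal, whose generator has no anxious root. -/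
theorem exists_calm_of_forall_anxious {k : ℕ} {hk : 2 ≤ k} {f : PowerSeries K} {n : ℕ}
    {c : ℕ → RatFunc K} (hf : SatisfiesMahlerEq k hk f n c)
    (h : ∀ α : K, IsAnxious k α → ∃ b : K[X], b.eval α ≠ 0 ∧
      b • f ∈ Submodule.span K[X] (Set.range fun i => shift k hk (i + 1) f)) :
    ∃ (n' : ℕ) (c' : ℕ → RatFunc K), SatisfiesMahlerEq k hk f n' c' ∧ IsCalmSeq k n' c' := by
  let I : Ideal K[X] := (Submodule.span K[X] (Set.range fun i => shift k hk (i + 1) f)).comap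
    (LinearMap.toSpanSingleton K[X] (PowerSeries K) f)
  have hI : ∀ b : K[X], b ∈ I ↔
      b • f ∈ Submodule.span K[X] (Set.range fun i => shift k hk (i + 1) f) := fun b => Iff.rfl
  set p := Submodule.IsPrincipal.generator I
  have hpI : p ∈ I := Submodule.IsPrincipal.generator_mem I
  have hdvd : ∀ b ∈ I, p ∣ b := fun b hb => (Submodule.IsPrincipal.mem_iff_generator_dvd I).1 hb
  have hroot : ∀ α : K, IsAnxious k α → p.eval α ≠ 0 := by
    intro α hα h0
    obtain ⟨b, hb, hbI⟩ := h α hα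
    exact hb (Polynomial.eval_eq_zero_of_dvd_of_eval_eq_zero (hdvd b hbI) h0)
  have hp0 : p ≠ 0 := by
    obtain ⟨a, ha⟩ := exists_common_denom (Finset.Icc 1 n) c
    have hb := prod_denom_ne_zero (Finset.Icc 1 n) c
    have h1 := (satisfiesMahlerEq_iff hb ha).1 hf
    refine ne_zero_of_dvd_ne_zero hb (hdvd _ ?_)
    rw [hI, polynomial_smul_eq, h1]
    refine Submodule.sum_mem _ fun i hi => ?_
    rw [← polynomial_smul_eq]
    refine Submodule.smul_mem _ _ (Submodule.subset_span ⟨i - 1, ?_⟩)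
    simp only
    rw [Nat.sub_add_cancel (Finset.mem_Icc.1 hi).1]
  obtain ⟨a, ha⟩ := Finsupp.mem_span_range_iff_exists_finsupp.1 ((hI p).1 hpI)
  obtain ⟨N, hN⟩ := a.support.bddAbove
  rw [Finsupp.sum_of_support_subset a (s := Finset.range (N + 1))
    (fun i hi => Finset.mem_range.2 (Nat.lt_succ_of_le (hN hi))) _ (by simp)] at ha
  simp only [polynomial_smul_eq] at ha
  have hs := sum_Icc_eq_sum_range 0 (N + 1) fun i =>
    (a (i - 1) : PowerSeries K) * shift k hk i f
  simp only [zero_add, add_comm 1, Nat.add_sub_cancel] at hs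
  refine ⟨N + 1, _, satisfiesMahlerEq_div (a := fun i => a (i - 1)) hp0 (ha.symm.trans ?_), ?_⟩
  · rw [hs]
  · intro i _ _ α hα
    refine noPoleAt_of_mul_eq (a := a (i - 1)) (hroot α hα) ?_
    have := RatFunc.algebraMap_ne_zero hp0
    field_simp

/-- An expression of `f` through `Δ_k^{m+1} f, …, Δ_k^{m+n} f` with coefficients regular at `α`,
after multiplication by a common denominator not vanishing at `α`. -/
theorem exists_smul_mem_of_noPoleAt {k : ℕ} {hk : 2 ≤ k} {f : PowerSeries K} {m n : ℕ}
    {d : ℕ → RatFunc K} (hf : (f : K⸨X⸩) = ∑ i ∈ Finset.Icc (m + 1) (m + n),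
      algebraMap (RatFunc K) K⸨X⸩ (d i) * (shift k hk i f : K⸨X⸩)) {α : K}
    (hd : ∀ i, m + 1 ≤ i → i ≤ m + n → NoPoleAt α (d i)) :
    ∃ b : K[X], b.eval α ≠ 0 ∧
      b • f ∈ Submodule.span K[X] (Set.range fun i => shift k hk (i + 1) f) := by
  obtain ⟨a, ha⟩ := exists_common_denom (Finset.Icc (m + 1) (m + n)) d
  have hb := prod_denom_ne_zero (Finset.Icc (m + 1) (m + n)) d
  have h1 := (laurent_eq_sum_iff hb ha f fun i => shift k hk i f).1 hf
  refine ⟨∏ j ∈ Finset.Icc (m + 1) (m + n), (d j).denom, ?_, ?_⟩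
  · rw [Polynomial.eval_prod, Finset.prod_ne_zero_iff]
    intro i hi
    rw [Finset.mem_Icc] at hi
    exact (noPoleAt_iff α _).1 (hd i hi.1 hi.2)
  · rw [polynomial_smul_eq, h1]
    refine Submodule.sum_mem _ fun i hi => ?_
    rw [← polynomial_smul_eq]
    refine Submodule.smul_mem _ _ (Submodule.subset_span ⟨i - 1, ?_⟩)
    simp only
    rw [Nat.sub_add_cancel (by rw [Finset.mem_Icc] at hi; omega)]

/-! ### Clearing calm poles -/

/-- For a calm `ζ ≠ 0` of order `N` and a prime `l` dividing both `N` and `k`, the polynomial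
`g = z^{N/l} - 1` does not vanish at `ζ`, while `g(z^k)` does. -/
theorem exists_X_sub_C_mul_dvd {k : ℕ} {ζ : K} (hζ : IsCalm k ζ) :
    ∃ (g : K[X]) (s : ℕ), g.eval 0 ≠ 0 ∧
      ∀ i, 1 ≤ i → (X - C ζ) * g ∣ X ^ s * Polynomial.expand K (k ^ i) g := by
  rcases hζ with rfl | ⟨hfin, hcop⟩
  · exact ⟨1, 1, by simp, fun i _ => by simp⟩
  · obtain ⟨l, hl, ⟨M, hM⟩, hlk⟩ := Nat.Prime.not_coprime_iff_dvd.1 hcop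
    have hN : 0 < orderOf ζ := hfin.orderOf_pos
    have hM0 : 0 < M := Nat.pos_of_ne_zero fun h => by rw [hM, h] at hN; simp at hN
    have hMN : M < orderOf ζ := by
      rw [hM]
      nlinarith [hl.two_le]
    refine ⟨X ^ M - 1, 0, by simp [hM0.ne'], fun i hi => ?_⟩
    have hexp : Polynomial.expand K (k ^ i) (X ^ M - 1) = (X ^ M) ^ k ^ i - 1 := by
      rw [map_sub, map_pow, Polynomial.expand_X, map_one, ← pow_mul, ← pow_mul, mul_comm]
    obtain ⟨Q, hQ⟩ : (X ^ M - 1 : K[X]) ∣ (X ^ M) ^ k ^ i - 1 := by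
      simpa using sub_dvd_pow_sub_pow (X ^ M : K[X]) 1 (k ^ i)
    rw [pow_zero, one_mul, hexp, hQ, mul_comm]
    refine mul_dvd_mul_left _ (dvd_iff_isRoot.2 ?_)
    have h1 := congrArg (Polynomial.eval ζ) hQ
    have h2 : ζ ^ (M * k ^ i) = 1 := by
      rw [← orderOf_dvd_iff_pow_eq_one, hM, mul_comm]
      exact mul_dvd_mul_left _ (hlk.trans (dvd_pow_self k (by omega)))
    have h3 : ζ ^ M - 1 ≠ 0 := by
      rw [sub_ne_zero]
      exact fun h => absurd (orderOf_le_of_pow_eq_one hM0 h) (by omega)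
    simp only [eval_sub, eval_pow, eval_X, eval_one, eval_mul, ← pow_mul, h2, sub_self] at h1
    exact (mul_eq_zero.1 h1.symm).resolve_left h3

/-- The substitution `f = g F` turns an equation `p f = ∑ p_i Δ_k^i f` into one for `F` whose
coefficients have no pole outside `0`. -/
theorem exists_mul_dvd_of_roots_calm [IsAlgClosed K] {k : ℕ} {p : K[X]} (hp : p ≠ 0)
    (hroots : ∀ α : K, p.eval α = 0 → IsCalm k α) :
    ∃ (g : K[X]) (s : ℕ), g.eval 0 ≠ 0 ∧
      ∀ i, 1 ≤ i → p * g ∣ X ^ s * Polynomial.expand K (k ^ i) g := by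
  have hmul : ∀ S : Multiset K, (∀ α ∈ S, IsCalm k α) → ∃ (g : K[X]) (s : ℕ), g.eval 0 ≠ 0 ∧
      ∀ i, 1 ≤ i → (S.map (X - C ·)).prod * g ∣ X ^ s * Polynomial.expand K (k ^ i) g := by
    intro S
    induction S using Multiset.induction with
    | empty =>
      exact fun _ => ⟨1, 0, by simp, fun i _ => by simp⟩
    | cons ζ S ih =>
      intro h
      obtain ⟨g₁, s₁, h₁, hd₁⟩ := ih fun α hα => h α (Multiset.mem_cons_of_mem hα)
      obtain ⟨g₂, s₂, h₂, hd₂⟩ := exists_X_sub_C_mul_dvd (h ζ (Multiset.mem_cons_self ζ S))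
      refine ⟨g₂ * g₁, s₂ + s₁, by rw [eval_mul]; exact mul_ne_zero h₂ h₁, fun i hi => ?_⟩
      rw [Multiset.map_cons, Multiset.prod_cons, mul_mul_mul_comm, map_mul, pow_add,
        mul_mul_mul_comm (X ^ s₂)]
      exact mul_dvd_mul (hd₂ i hi) (hd₁ i hi)
  obtain ⟨g, s, hg, hd⟩ := hmul p.roots fun α hα => hroots α (Polynomial.mem_roots hp |>.1 hα)
  refine ⟨g, s, hg, fun i hi => ?_⟩
  rw [(IsAlgClosed.splits p).eq_prod_roots, mul_assoc,
    (isUnit_C.2 (leadingCoeff_ne_zero.2 hp).isUnit).mul_left_dvd]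
  exact hd i hi

/-! ### Regularity of solutions -/

/-- The space of all `∑_{i=0}^n a_i(z) F(z^{k^i})` with polynomials `a_i` of degree at most `E`. -/
def boundedSpan (k : ℕ) (hk : 2 ≤ k) (n E : ℕ) (F : PowerSeries K) :
    Submodule K (PowerSeries K) :=
  Submodule.span K (Set.image2 (fun j i => PowerSeries.X ^ j * shift k hk i F)
    (Set.Iic E) (Set.Iic n))

instance (k : ℕ) (hk : 2 ≤ k) (n E : ℕ) (F : PowerSeries K) :
    FiniteDimensional K (boundedSpan k hk n E F) :=
  FiniteDimensional.span_of_finite K ((Set.finite_Iic E).image2 _ (Set.finite_Iic n))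

theorem mul_shift_mem_boundedSpan {k : ℕ} {hk : 2 ≤ k} {n E : ℕ} {F : PowerSeries K} {p : K[X]}
    (hp : p.natDegree ≤ E) {i : ℕ} (hi : i ≤ n) :
    (p : PowerSeries K) * shift k hk i F ∈ boundedSpan k hk n E F := by
  rw [p.as_sum_range_C_mul_X_pow, ← Polynomial.coeToPowerSeries.ringHom_apply, map_sum,
    Finset.sum_mul]
  refine Submodule.sum_mem _ fun j hj => ?_
  have hj' : j ≤ E := (Nat.lt_succ_iff.1 (Finset.mem_range.1 hj)).trans hp
  have h := Submodule.smul_mem (boundedSpan k hk n E F) (p.coeff j)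
    (Submodule.subset_span ⟨j, hj', i, hi, rfl⟩)
  simpa [PowerSeries.smul_eq_C_mul, mul_assoc] using h

theorem exists_of_mem_boundedSpan {k : ℕ} {hk : 2 ≤ k} {n E : ℕ} {F w : PowerSeries K}
    (hw : w ∈ boundedSpan k hk n E F) : ∃ a : ℕ → K[X], (∀ i, (a i).natDegree ≤ E) ∧
      w = ∑ i ∈ Finset.range (n + 1), (a i : PowerSeries K) * shift k hk i F := by
  induction hw using Submodule.span_induction with
  | mem w hw =>
    obtain ⟨j, hj, i, hi, rfl⟩ := hw
    refine ⟨fun i' => if i' = i then X ^ j else 0, fun i' => ?_, ?_⟩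
    · dsimp only
      split_ifs
      · simpa using hj
      · simp
    · rw [Finset.sum_eq_single_of_mem i (Finset.mem_range.2 (Nat.lt_succ_of_le hi))]
      · simp
      · intro i' _ hne
        simp [hne]
  | zero => exact ⟨0, by simp, by simp⟩
  | add w w' _ _ hw hw' =>
    obtain ⟨a, ha, rfl⟩ := hw
    obtain ⟨a', ha', rfl⟩ := hw'
    refine ⟨a + a', fun i => (natDegree_add_le _ _).trans (max_le (ha i) (ha' i)), ?_⟩
    simp [add_mul, Finset.sum_add_distrib]
  | smul t w _ hw =>
    obtain ⟨a, ha, rfl⟩ := hw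
    refine ⟨fun i => t • a i, fun i => (natDegree_smul_le _ _).trans (ha i), ?_⟩
    rw [Finset.smul_sum]
    simp [PowerSeries.smul_eq_C_mul, Polynomial.smul_eq_C_mul, mul_assoc]

/-- If `z^s F = ∑_{i=1}^n q_i(z) F(z^{k^i})`, then for large `D` the space
`z^{-D} boundedSpan k hk n (2 D) F` is stable under the Cartier operators. -/
theorem X_pow_mul_cartier_mem {k : ℕ} {hk : 2 ≤ k} {F : PowerSeries K} {s n d D : ℕ} {q : ℕ → K[X]}
    (hF : PowerSeries.X ^ s * F
      = ∑ i ∈ Finset.range n, (q i : PowerSeries K) * shift k hk (i + 1) F)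
    (hq : ∀ i < n, (q i).natDegree ≤ d) (hD : d + s ≤ D) {w : PowerSeries K}
    (hw : PowerSeries.X ^ D * w ∈ boundedSpan k hk n (2 * D) F) {r : ℕ} (hr : r < k) :
    PowerSeries.X ^ D * cartier k r w ∈ boundedSpan k hk n (2 * D) F := by
  obtain ⟨a, ha, haw⟩ := exists_of_mem_boundedSpan hw
  have hk0 : k ≠ 0 := by omega
  have hkD : 2 * D ≤ k * D := Nat.mul_le_mul_right D hk
  -- `z^{kD} w`, rewritten without `F` itself by means of the equation
  have h1 : w * PowerSeries.expand k hk0 (PowerSeries.X ^ D) = ∑ i ∈ Finset.range n,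
      ((X ^ (k * D - D - s) * a 0 * q i + X ^ (k * D - D) * a (i + 1) : K[X]) : PowerSeries K)
        * shift k hk (i + 1) F := by
    have h2 : w * PowerSeries.expand k hk0 (PowerSeries.X ^ D)
        = PowerSeries.X ^ (k * D - D) * (PowerSeries.X ^ D * w) := by
      rw [map_pow, PowerSeries.expand_X, ← pow_mul, ← mul_assoc, ← pow_add, mul_comm,
        Nat.sub_add_cancel (by omega)]
    have h3 : (PowerSeries.X : PowerSeries K) ^ (k * D - D)
        = PowerSeries.X ^ (k * D - D - s) * PowerSeries.X ^ s := by
      rw [← pow_add, Nat.sub_add_cancel (by omega)]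
    have h4 : PowerSeries.X ^ (k * D - D) * ((a 0 : PowerSeries K) * F)
        = ∑ i ∈ Finset.range n, ((X ^ (k * D - D - s) * a 0 * q i : K[X]) : PowerSeries K)
          * shift k hk (i + 1) F := by
      rw [h3, show PowerSeries.X ^ (k * D - D - s) * PowerSeries.X ^ s * ((a 0 : PowerSeries K) * F)
        = PowerSeries.X ^ (k * D - D - s) * (a 0 : PowerSeries K) * (PowerSeries.X ^ s * F) by ring,
        hF, Finset.mul_sum]
      refine Finset.sum_congr rfl fun i _ => ?_
      simp [mul_assoc]
    rw [h2, haw, Finset.sum_range_succ', shift_zero, mul_add, h4, Finset.mul_sum,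
      ← Finset.sum_add_distrib]
    refine Finset.sum_congr rfl fun i _ => ?_
    simp only [Polynomial.coe_add, Polynomial.coe_mul, Polynomial.coe_pow, Polynomial.coe_X]
    ring
  have h5 := congrArg (cartier k r) h1
  rw [cartier_mul_expand hk0 hr, mul_comm, map_sum] at h5
  rw [h5]
  refine Submodule.sum_mem _ fun i hi => ?_
  rw [Finset.mem_range] at hi
  have h6 := cartier_mul_shift hk (i := 1) (j := i) (r := r) (by simpa using hr)
    ((X ^ (k * D - D - s) * a 0 * q i + X ^ (k * D - D) * a (i + 1) : K[X]) : PowerSeries K) F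
  rw [pow_one, add_comm 1 i] at h6
  rw [h6]
  obtain ⟨p, hp, hpc⟩ := exists_coe_eq_cartier hk0 r
    (X ^ (k * D - D - s) * a 0 * q i + X ^ (k * D - D) * a (i + 1))
  rw [← hpc]
  refine mul_shift_mem_boundedSpan (hp.trans ?_) hi.le
  refine Nat.div_le_of_le_mul ((natDegree_add_le _ _).trans (max_le ?_ ?_))
  · refine natDegree_mul_le.trans ?_
    have e1 := natDegree_mul_le (p := X ^ (k * D - D - s)) (q := a 0)
    rw [natDegree_X_pow] at e1
    have e2 := ha 0
    have e3 := hq i hi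
    rw [mul_left_comm]
    omega
  · refine natDegree_mul_le.trans ?_
    rw [natDegree_X_pow]
    have e2 := ha (i + 1)
    rw [mul_left_comm]
    omega

theorem isRegularSeries_of_mul {k : ℕ} {hk : 2 ≤ k} {F : PowerSeries K} {s n : ℕ} {q : ℕ → K[X]}
    (hF : PowerSeries.X ^ s * F
      = ∑ i ∈ Finset.range n, (q i : PowerSeries K) * shift k hk (i + 1) F) (g : K[X]) :
    IsRegularSeries k ((g : PowerSeries K) * F) := by
  set d := ∑ i ∈ Finset.range n, (q i).natDegree
  have hq : ∀ i < n, (q i).natDegree ≤ d := fun i hi =>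
    Finset.single_le_sum (f := fun i => (q i).natDegree) (fun _ _ => Nat.zero_le _)
      (Finset.mem_range.2 hi)
  set D := d + s + g.natDegree with hD
  have hmem : ∀ e r, r < k ^ e →
      PowerSeries.X ^ D * cartier (k ^ e) r ((g : PowerSeries K) * F)
        ∈ boundedSpan k hk n (2 * D) F := by
    intro e
    induction e with
    | zero =>
      intro r hr
      obtain rfl : r = 0 := by simpa using hr
      have h1 : cartier (k ^ 0) 0 ((g : PowerSeries K) * F) = g * F := by
        ext
        simp
      have h2 := mul_shift_mem_boundedSpan (hk := hk) (F := F) (p := X ^ D * g) (E := 2 * D)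
        (natDegree_mul_le.trans (by rw [natDegree_X_pow]; omega)) (Nat.zero_le n)
      rw [h1]
      simpa [mul_assoc] using h2
    | succ e ih =>
      intro r hr
      have h1 : r % k ^ e < k ^ e := Nat.mod_lt _ (by positivity)
      have h2 : r / k ^ e < k := Nat.div_lt_of_lt_mul (by rwa [pow_succ] at hr)
      have h3 := X_pow_mul_cartier_mem hF hq (by omega) (ih _ h1) h2
      rwa [cartier_cartier, Nat.div_add_mod, ← pow_succ] at h3
  -- `φ` embeds sequences so that the kernel of `g F` lands in the stable finite-dimensional space
  let φ : (ℕ → K) →ₗ[K] PowerSeries K :=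
    { toFun := fun b => PowerSeries.X ^ D * PowerSeries.mk b
      map_add' := fun x y => mul_add _ _ _
      map_smul' := fun t x => mul_smul_comm t _ (PowerSeries.mk x) }
  have hφ : Function.Injective φ := fun x y hxy => by
    have h := mul_left_cancel₀ (pow_ne_zero D PowerSeries.X_ne_zero) hxy
    funext i
    simpa using congrArg (PowerSeries.coeff i) h
  have hle : Submodule.span K (kKernel k fun i => PowerSeries.coeff i ((g : PowerSeries K) * F))
      ≤ (boundedSpan k hk n (2 * D) F).comap φ := by
    rw [Submodule.span_le]
    rintro _ ⟨e, r, hr, rfl⟩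
    exact hmem e r hr
  exact FiniteDimensional.of_injective
    (φ.restrict (q := boundedSpan k hk n (2 * D) F) fun x hx => hle hx)
    fun x y hxy => Subtype.ext (hφ (congrArg Subtype.val hxy))

theorem isRegularSeries_of_isCalmSeq [IsAlgClosed K] {k : ℕ} {hk : 2 ≤ k} {f : PowerSeries K}
    {n : ℕ} {c : ℕ → RatFunc K} (hf : SatisfiesMahlerEq k hk f n c) (hc : IsCalmSeq k n c) :
    IsRegularSeries k f := by
  obtain ⟨a, ha⟩ := exists_common_denom (Finset.Icc 1 n) c
  have hb := prod_denom_ne_zero (Finset.Icc 1 n) c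
  have hroots : ∀ α : K, (∏ j ∈ Finset.Icc 1 n, (c j).denom).eval α = 0 → IsCalm k α := by
    intro α hα
    rw [Polynomial.eval_prod, Finset.prod_eq_zero_iff] at hα
    obtain ⟨i, hi, h0⟩ := hα
    rw [Finset.mem_Icc] at hi
    by_contra hcalm
    exact (noPoleAt_iff α _).1 (hc i hi.1 hi.2 α hcalm) h0
  generalize ∏ j ∈ Finset.Icc 1 n, (c j).denom = p at ha hb hroots
  have h1 := (satisfiesMahlerEq_iff hb ha).1 hf
  obtain ⟨g, s, hg, hdvd⟩ := exists_mul_dvd_of_roots_calm hb hroots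
  have hg0 : PowerSeries.constantCoeff (g : PowerSeries K) ≠ 0 := by
    rwa [Polynomial.constantCoeff_coe, 
      Polynomial.coeff_zero_eq_eval_zero]
  have hgF : (g : PowerSeries K) * ((g : PowerSeries K)⁻¹ * f) = f := by
    rw [← mul_assoc, PowerSeries.mul_inv_cancel _ hg0, one_mul]
  generalize (g : PowerSeries K)⁻¹ * f = F at hgF
  choose! t ht using hdvd
  have hgne : (g : PowerSeries K) ≠ 0 := fun h => hg0 (by rw [h, map_zero])
  rw [← hgF]
  refine isRegularSeries_of_mul (hk := hk) (s := s) (n := n) (q := fun i => a (i + 1) * t (i + 1))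
    ?_ g
  have hpg : (p : PowerSeries K) * g ≠ 0 := mul_ne_zero (by simpa using hb) hgne
  apply mul_left_cancel₀ hpg
  have hs := sum_Icc_eq_sum_range 0 n fun i => (a i : PowerSeries K) * shift k hk i f
  simp only [zero_add, add_comm 1] at hs
  rw [hs] at h1
  calc (p : PowerSeries K) * (g : PowerSeries K) * (PowerSeries.X ^ s * F)
      = PowerSeries.X ^ s * ((p : PowerSeries K) * f) := by rw [← hgF]; ring
    _ = _ := by
      rw [h1, Finset.mul_sum, Finset.mul_sum]
      refine Finset.sum_congr rfl fun i _ => ?_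
      have h2 := congrArg (fun u : K[X] => (u : PowerSeries K)) (ht (i + 1) (by omega))
      simp only [Polynomial.coe_mul, Polynomial.coe_pow, Polynomial.coe_X] at h2
      rw [← hgF, map_mul, shift_coe, Polynomial.coe_mul]
      linear_combination (a (i + 1) : PowerSeries K) * shift k hk (i + 1) F * h2

/-! ### The equivalence -/

theorem exists_calm_of_noPoleAt_specialCoeff {k : ℕ} {hk : 2 ≤ k} {f : PowerSeries K} {n : ℕ}
    {c : ℕ → RatFunc K} (hf : SatisfiesMahlerEq k hk f n c)
    (h : ∀ α ∈ anxiousPoles k n c, ∃ m : ℕ, ∀ i, m + 1 ≤ i → i ≤ m + n →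
      NoPoleAt α (specialCoeff k hk n c i m)) :
    ∃ (n' : ℕ) (c' : ℕ → RatFunc K), SatisfiesMahlerEq k hk f n' c' ∧ IsCalmSeq k n' c' := by
  refine exists_calm_of_forall_anxious hf fun α hα => ?_
  by_cases hαV : α ∈ anxiousPoles k n c
  · obtain ⟨m, hm⟩ := h α hαV
    exact exists_smul_mem_of_noPoleAt (hf.eq_sum_specialCoeff m) hm
  · have hc : ∀ i, 0 + 1 ≤ i → i ≤ 0 + n → NoPoleAt α (c i) := by
      intro i h1 h2
      by_contra hpole
      exact hαV ⟨hα, i, by omega, by omega, hpole⟩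
    refine exists_smul_mem_of_noPoleAt (d := c) (hk := hk) ?_ hc
    rw [zero_add, zero_add]
    exact hf

theorem exists_noPoleAt_of_isRegularSeries [IsAlgClosed K] {k : ℕ} {hk : 2 ≤ k} {f : PowerSeries K}
    {n : ℕ} {c : ℕ → RatFunc K} (hf : SatisfiesMahlerEq k hk f n c)
    (hmin : ∀ n' < n, ¬ ∃ c' : ℕ → RatFunc K, SatisfiesMahlerEq k hk f n' c')
    (hreg : IsRegularSeries k f) {α : K} (h0 : α ≠ 0) (hα : ¬ IsOfFinOrder α) :
    ∃ m : ℕ, (∀ i, m + 1 ≤ i → i ≤ m + n → NoPoleAt α (specialCoeff k hk n c i m)) ∧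
      ∀ j, m < j → ∀ i, 1 ≤ i → i ≤ n → NoPoleAt (α ^ k ^ j) (c i) := by
  obtain ⟨P, hP0, hP⟩ := exists_uniform_denom hf hreg
  obtain ⟨m, hm⟩ := exists_forall_eval_pow_ne_zero hk h0 hα
    (mul_ne_zero hP0 (prod_denom_ne_zero (Finset.Icc 1 n) c))
  refine ⟨m, fun i h1 h2 => noPoleAt_specialCoeff hf hmin hP (fun hz => ?_) h1 h2,
    fun j hj i h1 h2 => (noPoleAt_iff _ _).2 fun hz => hm j hj ?_⟩
  · exact hm (m + 1) (by omega) (by rw [eval_mul, hz, zero_mul])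
  · rw [eval_mul, eval_prod, Finset.prod_eq_zero (Finset.mem_Icc.2 ⟨h1, h2⟩) hz, mul_zero]

end MahlerRegularity

end

theorem mainTheorem2 {K : Type*} [Field K] [IsAlgClosed K] (k : ℕ) (hk : 2 ≤ k)
    (hchar : ringChar K ≠ 0 → k.Coprime (ringChar K))
    (f : PowerSeries K) (n : ℕ) (c : ℕ → RatFunc K)
    (hf : MahlerRegularity.SatisfiesMahlerEq k hk f n c)
    (hmin : ∀ n' < n, ¬ ∃ c' : ℕ → RatFunc K, MahlerRegularity.SatisfiesMahlerEq k hk f n' c')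
    (hV : ∀ α ∈ MahlerRegularity.anxiousPoles k n c, ¬ IsOfFinOrder α) :
    List.TFAE
      [∀ α ∈ MahlerRegularity.anxiousPoles k n c, ∃ m : ℕ,
          (∀ i, m + 1 ≤ i → i ≤ m + n →
            MahlerRegularity.NoPoleAt α (MahlerRegularity.specialCoeff k hk n c i m)) ∧
          (∀ j, m < j → ∀ i, 1 ≤ i → i ≤ n → MahlerRegularity.NoPoleAt (α ^ k ^ j) (c i)),
        ∃ (n' : ℕ) (c' : ℕ → RatFunc K),
          MahlerRegularity.SatisfiesMahlerEq k hk f n' c' ∧ MahlerRegularity.IsCalmSeq k n' c',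
        MahlerRegularity.IsRegularSeries k f] := by
  tfae_have 1 → 2 := fun h =>
    MahlerRegularity.exists_calm_of_noPoleAt_specialCoeff hf fun α hα =>
      (h α hα).imp fun _ hm => hm.1
  tfae_have 2 → 3 := fun ⟨_, _, hf', hc'⟩ => MahlerRegularity.isRegularSeries_of_isCalmSeq hf' hc'
  tfae_have 3 → 1 := fun hreg α hα =>
    MahlerRegularity.exists_noPoleAt_of_isRegularSeries hf hmin hreg hα.1.ne_zero (hV α hα)
  tfae_finish
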